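/- **Theorem (Stability).** Let $d\in\{2,3\}$, let $\Omega\subset\mathbb R^d$ be a bounded open set, and write $(\cdot,\cdot)$, $\|\cdot\|$ for the $L^2(\Omega)$ inner product and norm. Let $X=H^1_0(\Omega)^d$ (the closure of $C_c^\infty(\Omega)^d$ in $H^1(\Omega)^d$), let $\|f\|_{-1}=\sup_{0\ne v\in X}|(f,v)|/\|\nabla v\|$ for $f\in X'=H^{-1}(\Omega)^d$, where $(f,v)$ denotes the duality pairing, and let $$b^*(u,v,w)=\tfrac12(u\cdot\nabla v,w)-\tfrac12(u\cdot\nabla w,v).$$ Let $k\in\mathbb N$ and $\sigma>0$. There is a constant $C>0$, depending only on $d,\Omega,k,\sigma$, such that the following holds. Let $\mathcal T_h$ be a mesh of finitely many compact convex cells (for instance simplices) with nonempty, pairwise disjoint interiors contained in $\Omega$, let $h$ be the largest diameter of a cell, and suppose that every cell contains a ball of radius $\sigma h$ (shape regularity and quasi-uniformity). Let $X^h\subset X$ be a conforming finite element space on $\mathcal T_h$: a linear subspace whose members are, on each cell, componentwise polynomials of degree at most $k$, and vanish on the part of $\Omega$ not covered by the mesh (if any). Let $Q^h\subset L^2_0(\Omega)=\{q\in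 L^2(\Omega):\int_\Omega q=0\}$ be a finite-dimensional subspace, with $L^2$-orthogonal projection $P_{Q^h}$. Let $\nu,\epsilon,\Delta t>0$, let $J\ge1$ and $N\ge0$ be integers, and let $f_j^{n+1}\in H^{-1}(\Omega)^d$ for $1\le j\le J$, $0\le n<N$. Let $u^n_{j}\in X^h$ ($0\le n\le N$) and $p^{n}_{j}\in Q^h$ ($1\le n\le N$) satisfy the IMEX ensemble penalty method: with $\langle u\rangle^n=\frac1J\sum_{j=1}^J u_j^n$, for all $1\le j\le J$, $0\le n<N$ and all $(v,q)\in X^h\times Q^h$, $$\begin{aligned}&\tfrac1{\Delta t}(u_j^{n+1}-u_j^n,v)+b^*(\langle u\rangle^n,u_j^{n+1},v)+b^*(u_j^n-\langle u\rangle^n,u_j^n,v)+\nu(\nabla u_j^{n+1},\nabla v)\\&\quad-(p_j^{n+1},\nabla\cdot v)+(q,\nabla\cdot u_j^{n+1})+\epsilon(p_j^{n+1},q)=(f_j^{n+1},v).\end{aligned}$$ If, for some $j$, the CFL condition $$C\,\frac{\Delta t}{\nu h}\,\|\nabla(u_j^n-\langle u\rangle^n)\|^2\le1\qquad(0\le n<N)$$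 holds, then, for this $j$, $$\begin{aligned}&\tfrac12\|u_j^N\|^2+\tfrac14\sum_{n=0}^{N-1}\|u_j^{n+1}-u_j^n\|^2+\tfrac{\nu\Delta t}4\|\nabla u_j^N\|^2+\tfrac{\nu\Delta t}4\sum_{n=0}^{N-1}\|\nabla u_j^{n+1}\|^2+\tfrac{\Delta t}{\epsilon}\sum_{n=0}^{N-1}\|P_{Q^h}(\nabla\cdot u_j^{n+1})\|^2\\&\qquad\le\tfrac{\Delta t}{2\nu}\sum_{n=0}^{N-1}\|f_j^{n+1}\|_{-1}^2+\tfrac12\|u_j^0\|^2+\tfrac{\nu\Delta t}4\|\nabla u_j^0\|^2.\end{aligned}$$ -/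

import Mathlib

open MeasureTheory
open scoped ContDiff

noncomputable section

namespace PenaltyEnsemble

/-- `ℝ^d` with the Euclidean norm. -/
abbrev Vec (d : ℕ) := EuclideanSpace ℝ (Fin d)

/-- `d × d` real matrices with the Frobenius norm; the entry `(i, j)` of a velocity gradient is
`∂_j u_i`. -/
abbrev Mat (d : ℕ) := EuclideanSpace ℝ (Fin d × Fin d)

/-- `L²(Ω; F)`. -/
abbrev L2 {d : ℕ} (Ω : Set (Vec d)) (F : Type) [NormedAddCommGroup F] :=
  Lp F 2 (volume.restrict Ω)

/-- Pairs `(u, G)` in `L²(Ω)^d × L²(Ω)^{d × d}`, with norm `(‖u‖² + ‖G‖²)^{1/2}`. -/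
abbrev L2Pair {d : ℕ} (Ω : Set (Vec d)) := WithLp 2 (L2 Ω (Vec d) × L2 Ω (Mat d))

/-- `φ ∈ C_c^∞(Ω; F)`. -/
def IsTest {d : ℕ} {F : Type} [NormedAddCommGroup F] [NormedSpace ℝ F]
    (Ω : Set (Vec d)) (φ : Vec d → F) : Prop :=
  ContDiff ℝ ∞ φ ∧ HasCompactSupport φ ∧ tsupport φ ⊆ Ω

/-- The partial derivative `∂_j φ (x)`. -/
def partialD {d : ℕ} {F : Type} [NormedAddCommGroup F] [NormedSpace ℝ F]
    (j : Fin d) (φ : Vec d → F) (x : Vec d) : F :=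
  fderiv ℝ φ x (EuclideanSpace.single j 1)

/-- The classical gradient of a smooth vector field. -/
def jacobian {d : ℕ} (φ : Vec d → Vec d) (x : Vec d) : Mat d :=
  WithLp.toLp 2 fun ij : Fin d × Fin d => partialD ij.2 φ x ij.1

lemma IsTest.zero {d : ℕ} {F : Type} [NormedAddCommGroup F] [NormedSpace ℝ F]
    (Ω : Set (Vec d)) : IsTest Ω (fun _ => (0 : F)) := by
  refine ⟨contDiff_const, HasCompactSupport.zero, ?_⟩
  have : tsupport (fun _ : Vec d => (0 : F)) = ∅ := tsupport_eq_empty_iff.2 rfl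
  simp [this]

lemma IsTest.add {d : ℕ} {F : Type} [NormedAddCommGroup F] [NormedSpace ℝ F]
    {Ω : Set (Vec d)} {φ ψ : Vec d → F} (hφ : IsTest Ω φ) (hψ : IsTest Ω ψ) :
    IsTest Ω (fun x => φ x + ψ x) :=
  ⟨hφ.1.add hψ.1, hφ.2.1.add hψ.2.1,
    (tsupport_add φ ψ).trans (Set.union_subset hφ.2.2 hψ.2.2)⟩

lemma IsTest.smul {d : ℕ} {F : Type} [NormedAddCommGroup F] [NormedSpace ℝ F]
    {Ω : Set (Vec d)} {φ : Vec d → F} (c : ℝ) (hφ : IsTest Ω φ) :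
    IsTest Ω (fun x => c • φ x) := by
  refine ⟨hφ.1.const_smul c, hφ.2.1.smul_left (f := fun _ => c), ?_⟩
  exact (closure_mono (Function.support_const_smul_subset c φ)).trans hφ.2.2

lemma IsTest.memLp {d : ℕ} {Ω : Set (Vec d)} {φ : Vec d → ℝ} (hφ : IsTest Ω φ) :
    MemLp φ 2 (volume.restrict Ω) :=
  (hφ.1.continuous.memLp_of_hasCompactSupport hφ.2.1).restrict Ω

lemma IsTest.memLp_partialD {d : ℕ} {Ω : Set (Vec d)} {φ : Vec d → ℝ} (hφ : IsTest Ω φ)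
    (j : Fin d) : MemLp (partialD j φ) 2 (volume.restrict Ω) := by
  have h1 : Continuous (partialD j φ) :=
    (hφ.1.continuous_fderiv (by simp)).clm_apply continuous_const
  have h2 : HasCompactSupport (partialD j φ) := hφ.2.1.fderiv_apply ℝ _
  exact (h1.memLp_of_hasCompactSupport h2).restrict Ω

lemma memLp_coord {d : ℕ} {Ω : Set (Vec d)} {ι : Type} [Fintype ι]
    (u : L2 Ω (EuclideanSpace ℝ ι)) (i : ι) :
    MemLp (fun x => u x i) 2 (volume.restrict Ω) :=
  (EuclideanSpace.proj (𝕜 := ℝ) i).comp_memLp' (Lp.memLp u)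

/-- `H¹(Ω)^d`: the pairs `(u, G)` of square integrable functions such that `G` is the weak gradient
of `u` on `Ω`, i.e. `∫_Ω u_i ∂_j φ = - ∫_Ω G_{ij} φ` for all `φ ∈ C_c^∞(Ω)`. -/
def H1 {d : ℕ} (Ω : Set (Vec d)) : Submodule ℝ (L2Pair Ω) where
  carrier := {w | ∀ φ : Vec d → ℝ, IsTest Ω φ → ∀ i j : Fin d,
    ∫ x in Ω, w.fst x i * partialD j φ x = - ∫ x in Ω, w.snd x (i, j) * φ x}
  zero_mem' := by
    intro φ hφ i j
    have h1 : ∫ x in Ω, (0 : L2Pair Ω).fst x i * partialD j φ x = 0 := by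
      apply integral_eq_zero_of_ae
      filter_upwards [Lp.coeFn_zero (Vec d) 2 (volume.restrict Ω)] with x hx
      replace hx : (0 : L2Pair Ω).fst x = 0 := hx
      rw [hx]
      simp
    have h2 : ∫ x in Ω, (0 : L2Pair Ω).snd x (i, j) * φ x = 0 := by
      apply integral_eq_zero_of_ae
      filter_upwards [Lp.coeFn_zero (Mat d) 2 (volume.restrict Ω)] with x hx
      replace hx : (0 : L2Pair Ω).snd x = 0 := hx
      rw [hx]
      simp
    rw [h1, h2, neg_zero]
  add_mem' := by
    intro a b ha hb φ hφ i j
    have h1 : ∫ x in Ω, (a + b).fst x i * partialD j φ x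
        = ∫ x in Ω, (a.fst x i * partialD j φ x + b.fst x i * partialD j φ x) := by
      apply integral_congr_ae
      filter_upwards [Lp.coeFn_add a.fst b.fst] with x hx
      replace hx : (a + b).fst x = a.fst x + b.fst x := hx
      rw [hx, PiLp.add_apply, add_mul]
    have h2 : ∫ x in Ω, (a + b).snd x (i, j) * φ x
        = ∫ x in Ω, (a.snd x (i, j) * φ x + b.snd x (i, j) * φ x) := by
      apply integral_congr_ae
      filter_upwards [Lp.coeFn_add a.snd b.snd] with x hx
      replace hx : (a + b).snd x = a.snd x + b.snd x := hx
      rw [hx, PiLp.add_apply, add_mul]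
    have h3 : ∫ x in Ω, (a.fst x i * partialD j φ x + b.fst x i * partialD j φ x)
        = (∫ x in Ω, a.fst x i * partialD j φ x) + ∫ x in Ω, b.fst x i * partialD j φ x :=
      integral_add ((memLp_coord a.fst i).integrable_mul (hφ.memLp_partialD j))
        ((memLp_coord b.fst i).integrable_mul (hφ.memLp_partialD j))
    have h4 : ∫ x in Ω, (a.snd x (i, j) * φ x + b.snd x (i, j) * φ x)
        = (∫ x in Ω, a.snd x (i, j) * φ x) + ∫ x in Ω, b.snd x (i, j) * φ x :=
      integral_add ((memLp_coord a.snd (i, j)).integrable_mul hφ.memLp)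
        ((memLp_coord b.snd (i, j)).integrable_mul hφ.memLp)
    rw [h1, h2, h3, h4, ha φ hφ i j, hb φ hφ i j]
    ring
  smul_mem' := by
    intro c a ha φ hφ i j
    have h1 : ∫ x in Ω, (c • a).fst x i * partialD j φ x
        = ∫ x in Ω, c * (a.fst x i * partialD j φ x) := by
      apply integral_congr_ae
      filter_upwards [Lp.coeFn_smul c a.fst] with x hx
      simp [hx, mul_assoc]
    have h2 : ∫ x in Ω, (c • a).snd x (i, j) * φ x
        = ∫ x in Ω, c * (a.snd x (i, j) * φ x) := by
      apply integral_congr_ae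
      filter_upwards [Lp.coeFn_smul c a.snd] with x hx
      simp [hx, mul_assoc]
    rw [h1, h2, integral_const_mul, integral_const_mul, ha φ hφ i j]
    ring

/-- The pairs `(φ, ∇φ)` with `φ ∈ C_c^∞(Ω)^d`. -/
def testPairs {d : ℕ} (Ω : Set (Vec d)) : Submodule ℝ (L2Pair Ω) where
  carrier := {w | ∃ φ : Vec d → Vec d, IsTest Ω φ ∧
    w.fst =ᵐ[volume.restrict Ω] φ ∧ w.snd =ᵐ[volume.restrict Ω] jacobian φ}
  zero_mem' := by
    refine ⟨fun _ => 0, IsTest.zero Ω, Lp.coeFn_zero _ _ _, ?_⟩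
    filter_upwards [Lp.coeFn_zero (Mat d) 2 (volume.restrict Ω)] with x hx
    replace hx : (0 : L2Pair Ω).snd x = 0 := hx
    rw [hx]
    ext ij
    simp [jacobian, partialD]
  add_mem' := by
    rintro a b ⟨φ, hφ, hφ1, hφ2⟩ ⟨ψ, hψ, hψ1, hψ2⟩
    refine ⟨fun x => φ x + ψ x, hφ.add hψ, ?_, ?_⟩
    · filter_upwards [Lp.coeFn_add a.fst b.fst, hφ1, hψ1] with x hx h1 h2
      replace hx : (a + b).fst x = a.fst x + b.fst x := hx
      rw [hx, h1, h2]
    · filter_upwards [Lp.coeFn_add a.snd b.snd, hφ2, hψ2] with x hx h1 h2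
      have e := fderiv_fun_add (𝕜 := ℝ) ((hφ.1.differentiable (by simp)) x)
        ((hψ.1.differentiable (by simp)) x)
      replace hx : (a + b).snd x = a.snd x + b.snd x := hx
      rw [hx, h1, h2]
      ext ij
      simp [jacobian, partialD, e]
  smul_mem' := by
    rintro c a ⟨φ, hφ, hφ1, hφ2⟩
    refine ⟨fun x => c • φ x, hφ.smul c, ?_, ?_⟩
    · filter_upwards [Lp.coeFn_smul c a.fst, hφ1] with x hx h1
      simp [hx, h1]
    · filter_upwards [Lp.coeFn_smul c a.snd, hφ2] with x hx h1
      have e := fderiv_fun_const_smul (𝕜 := ℝ) ((hφ.1.differentiable (by simp)) x) c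
      ext ij
      simp [hx, h1, jacobian, partialD, e]

/-- `X = H¹₀(Ω)^d`: the closure of `C_c^∞(Ω)^d` in `H¹(Ω)^d`. -/
def H10 {d : ℕ} (Ω : Set (Vec d)) : Submodule ℝ (L2Pair Ω) :=
  H1 Ω ⊓ (testPairs Ω).topologicalClosure

section Forms

variable {d : ℕ} {Ω : Set (Vec d)}

/-- The velocity field itself, as an element of `L²(Ω)^d`. -/
def val (u : H10 Ω) : L2 Ω (Vec d) := (u : L2Pair Ω).fst

/-- `∇u`, as an element of `L²(Ω)^{d × d}`. -/
def grad (u : H10 Ω) : L2 Ω (Mat d) := (u : L2Pair Ω).snd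

/-- The trace of a matrix. -/
def traceCLM (d : ℕ) : Mat d →L[ℝ] ℝ := ∑ i : Fin d, EuclideanSpace.proj (𝕜 := ℝ) (i, i)

/-- `∇ · u`, as an element of `L²(Ω)`. -/
def divg (u : H10 Ω) : L2 Ω ℝ := (traceCLM d).compLp (grad u)

/-- `(u · ∇v, w) = ∫_Ω ∑_{i,j} u_j (∂_j v_i) w_i`. -/
def conv (u v w : H10 Ω) : ℝ :=
  ∫ x in Ω, ∑ i : Fin d, ∑ j : Fin d, val u x j * grad v x (i, j) * val w x i

/-- `b*(u, v, w) = ½ (u · ∇v, w) - ½ (u · ∇w, v)`. -/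
def bStar (u v w : H10 Ω) : ℝ := 1 / 2 * conv u v w - 1 / 2 * conv u w v

/-- `‖f‖₋₁ = sup_{v ∈ H¹₀(Ω)^d, v ≠ 0} |(f, v)| / ‖∇v‖` for a continuous linear functional `f`
on `H¹₀(Ω)^d` (the zero field only contributes the value `0`). -/
def normNegOne (f : H10 Ω →L[ℝ] ℝ) : ℝ := ⨆ v : H10 Ω, |f v| / ‖grad v‖

/-- The ensemble mean `<u>ⁿ`. -/
def mean {J : ℕ} (u : Fin J → ℕ → H10 Ω) (n : ℕ) : H10 Ω := (J : ℝ)⁻¹ • ∑ j, u j n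

end Forms

/-- A mesh in `Ω`: finitely many compact convex cells with nonempty, pairwise disjoint interiors
contained in `Ω` (for instance the simplices of a triangulation). -/
structure Mesh {d : ℕ} (Ω : Set (Vec d)) where
  cells : Finset (Set (Vec d))
  convex : ∀ K ∈ cells, Convex ℝ K
  compact : ∀ K ∈ cells, IsCompact K
  interior_nonempty : ∀ K ∈ cells, (interior K).Nonempty
  interior_subset : ∀ K ∈ cells, interior K ⊆ Ω
  disjoint : ∀ K ∈ cells, ∀ L ∈ cells, K ≠ L → Disjoint (interior K) (interior L)

/-- The mesh size `h`: the largest diameter of a cell. -/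
def Mesh.size {d : ℕ} {Ω : Set (Vec d)} (T : Mesh Ω) : ℝ := ⨆ K : T.cells, Metric.diam K.1

/-- Shape regularity and quasi-uniformity: every cell contains a ball of radius `σ h`. -/
def Mesh.QuasiUniform {d : ℕ} {Ω : Set (Vec d)} (T : Mesh Ω) (σ : ℝ) : Prop :=
  ∀ K ∈ T.cells, ∃ c : Vec d, Metric.ball c (σ * T.size) ⊆ K

/-- `Xh` is a conforming finite element velocity space of degree at most `k` on the mesh: a
subspace of `H¹₀(Ω)^d` whose members are polynomial of degree at most `k` on every cell, and vanish
on the part of `Ω` that is not covered by the mesh, if there is one (e.g. near a curved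
boundary). -/
def IsFEVelocitySpace {d : ℕ} {Ω : Set (Vec d)} (T : Mesh Ω) (k : ℕ)
    (Xh : Submodule ℝ (H10 Ω)) : Prop :=
  ∀ v ∈ Xh,
    (∀ K ∈ T.cells, ∃ p : Fin d → MvPolynomial (Fin d) ℝ, (∀ i, (p i).totalDegree ≤ k) ∧
      ∀ᵐ x ∂(volume.restrict (interior K)), ∀ i, val v x i = MvPolynomial.eval (fun m => x m) (p i))
    ∧ ∀ᵐ x ∂(volume.restrict (Ω \ ⋃ K ∈ T.cells, K)), val v x = 0

/-- The first `N` steps of the fully discrete ensemble penalty method with viscosity `ν`, penalty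
parameter `ε` and time step `Δt`: all iterates lie in `Xh` and `Qh`, and
`(1/Δt) (u_jⁿ⁺¹ - u_jⁿ, v) + b*(<u>ⁿ, u_jⁿ⁺¹, v) + b*(u_jⁿ - <u>ⁿ, u_jⁿ, v) + ν (∇u_jⁿ⁺¹, ∇v)
- (p_jⁿ⁺¹, ∇·v) + (q, ∇·u_jⁿ⁺¹) + ε (p_jⁿ⁺¹, q) = (f_jⁿ⁺¹, v)` for all `v ∈ Xh`, `q ∈ Qh`. -/
structure IsEnsembleSolution {d : ℕ} {Ω : Set (Vec d)} (Xh : Submodule ℝ (H10 Ω))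
    (Qh : Submodule ℝ (L2 Ω ℝ)) (ν ε Δt : ℝ) {J : ℕ} (f : Fin J → ℕ → (H10 Ω →L[ℝ] ℝ)) (N : ℕ)
    (u : Fin J → ℕ → H10 Ω) (p : Fin J → ℕ → L2 Ω ℝ) : Prop where
  velocity_mem : ∀ j, ∀ n ≤ N, u j n ∈ Xh
  pressure_mem : ∀ j, ∀ n < N, p j (n + 1) ∈ Qh
  step : ∀ j, ∀ n < N, ∀ v ∈ Xh, ∀ q ∈ Qh,
    1 / Δt * inner ℝ (val (u j (n + 1) - u j n)) (val v)
      + bStar (mean u n) (u j (n + 1)) v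
      + bStar (u j n - mean u n) (u j n) v
      + ν * inner ℝ (grad (u j (n + 1))) (grad v)
      - inner ℝ (p j (n + 1)) (divg v)
      + inner ℝ q (divg (u j (n + 1)))
      + ε * inner ℝ (p j (n + 1)) q
      = f j (n + 1) v

end PenaltyEnsemble

end

namespace PenaltyEnsemble

/-! Testing the scheme with `v = u_j^{n+1}`, `q = p_j^{n+1}` cancels the pressure-divergence terms,
and the skew form of `b*` kills `b*(<u>^n, u_j^{n+1}, u_j^{n+1})`. The only term without a sign is
the explicit one. Write `w = u_j^n - <u>^n`; since `b*(w, u_j^n, u_j^n) = 0`, that term equals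
`b*(w, u_j^n, u_j^{n+1} - u_j^n)`, so it is small with the increment.

The analytic core is `exists_abs_bStar_le`: on the finite element space, `|b*(w, u, v)| ≤ K h^{-1/2}
‖∇w‖ ‖∇u‖ ‖v‖`, with no derivative on `v`. Integration by parts (`conv_by_parts`) moves the
derivative off `v`; Hölder with exponents 6, 2, 3 and the Sobolev embedding into `L⁶`
(`exists_eLpNorm_six_le`) leave `‖v‖` in `L³`. An inverse inequality, obtained by interpolating
between `L²` and the sup bound `exists_norm_le_of_mem`, bounds it by `h^{-1/2} ‖v‖`.

Young's inequality then absorbs the explicit term into `¼ ‖u_j^{n+1} - u_j^n‖²` and, by the CFL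
condition, `¼ ν Δt ‖∇u_j^n‖²`. The latter telescopes against part of the viscous dissipation. The
penalty term is rewritten with `P_{Q^h}(∇·u) = -ε p`, and the one-step estimate `energy_step` is
summed over `n`. -/

/-! ### Sobolev and Poincaré inequalities on `H¹₀`, and the dual norm. -/

lemma norm_le_sum_abs {ι : Type} [Fintype ι] (x : EuclideanSpace ℝ ι) : ‖x‖ ≤ ∑ i, |x i| := by
  rw [EuclideanSpace.norm_eq]
  apply Real.sqrt_le_iff.2 ⟨Finset.sum_nonneg fun i _ => abs_nonneg _, ?_⟩
  simpa using Finset.sum_sq_le_sq_sum_of_nonneg (s := Finset.univ) (f := fun i => |x i|)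
    (fun i _ => abs_nonneg _)

lemma abs_apply_le_norm {ι : Type} [Fintype ι] (x : EuclideanSpace ℝ ι) (i : ι) : |x i| ≤ ‖x‖ := by
  simpa using PiLp.norm_apply_le x i

/-- Passes from the operator norm, used by the Gagliardo–Nirenberg–Sobolev inequality, to the
Frobenius norm of the gradient. The constant is crude. -/
lemma norm_fderiv_le_jacobian {d : ℕ} (φ : Vec d → Vec d) (x : Vec d) :
    ‖fderiv ℝ φ x‖ ≤ (d ^ 2 : ℕ) * ‖jacobian φ x‖ := by
  refine ContinuousLinearMap.opNorm_le_bound _ (by positivity) fun y => ?_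
  have hy : y = ∑ j, y j • EuclideanSpace.single j (1 : ℝ) := by
    ext i
    simp [Finset.sum_apply, Pi.single_apply]
  have hb : ∀ i j, |partialD j φ x i| ≤ ‖jacobian φ x‖ := fun i j =>
    abs_apply_le_norm (jacobian φ x) (i, j)
  have hj : ∀ j, ‖partialD j φ x‖ ≤ d * ‖jacobian φ x‖ := fun j =>
    (norm_le_sum_abs _).trans <| (Finset.sum_le_sum fun i _ => hb i j).trans (by simp)
  calc ‖fderiv ℝ φ x y‖ = ‖∑ j, y j • partialD j φ x‖ := by
        conv_lhs => rw [hy]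
        simp [partialD]
    _ ≤ ∑ j : Fin d, ‖y‖ * (d * ‖jacobian φ x‖) := by
        refine (norm_sum_le _ _).trans (Finset.sum_le_sum fun j _ => ?_)
        rw [norm_smul]
        exact mul_le_mul (PiLp.norm_apply_le y j) (hj j) (norm_nonneg _) (norm_nonneg _)
    _ = (d ^ 2 : ℕ) * ‖jacobian φ x‖ * ‖y‖ := by
        simp
        ring

lemma IsTest.continuous_jacobian {d : ℕ} {Ω : Set (Vec d)} {φ : Vec d → Vec d}
    (hφ : IsTest Ω φ) : Continuous (jacobian φ) := by
  refine (PiLp.continuous_toLp 2 _).comp (continuous_pi fun ij => ?_)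
  exact (EuclideanSpace.proj (𝕜 := ℝ) ij.1).continuous.comp
    ((hφ.1.continuous_fderiv (by simp)).clm_apply continuous_const)

/-- The Sobolev inequality for smooth compactly supported fields on a bounded open set. -/
lemma exists_eLpNorm_six_le_of_isTest {d : ℕ} (hd : d = 2 ∨ d = 3) {Ω : Set (Vec d)}
    (hΩb : Bornology.IsBounded Ω) :
    ∃ S : NNReal, ∀ φ : Vec d → Vec d, IsTest Ω φ →
      eLpNorm φ 6 (volume.restrict Ω) ≤ S * eLpNorm (jacobian φ) 2 (volume.restrict Ω) := by
  -- The exponent `p` whose Sobolev conjugate `dp/(d-p)` is 6: `3/2` for `d = 2` and `2` for `d =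
  -- 3`. As `p ≤ 2` and `Ω` is bounded, the `L^p` norm of the gradient is controlled by its `L²`
  -- norm.
  obtain ⟨p, hp1, hpd, hp6, hp2⟩ : ∃ p : NNReal, 1 ≤ p ∧ p < d ∧
      (p : ℝ)⁻¹ - (d : ℝ)⁻¹ ≤ ((6 : NNReal) : ℝ)⁻¹ ∧ p ≤ 2 := by
    rcases hd with rfl | rfl
    · exact ⟨3 / 2, NNReal.coe_le_coe.1 (by norm_num), NNReal.coe_lt_coe.1 (by norm_num),
        by norm_num, NNReal.coe_le_coe.1 (by norm_num)⟩
    · refine ⟨2, ?_, ?_, by norm_num, ?_⟩ <;> norm_num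
  set μ := volume.restrict Ω
  have hvol : volume Ω ≠ ⊤ := hΩb.measure_lt_top.ne
  set e : ℝ := 1 / (p : ENNReal).toReal - 1 / (2 : ENNReal).toReal
  have he : 0 ≤ e := by
    have h1 : (0 : ℝ) < p := by exact_mod_cast zero_lt_one.trans_le hp1
    have h2 : (p : ℝ) ≤ 2 := by exact_mod_cast hp2
    simp only [e, ENNReal.coe_toReal, ENNReal.toReal_ofNat, sub_nonneg]
    exact one_div_le_one_div_of_le h1 h2
  set A : NNReal := eLpNormLESNormFDerivOfLeConst (Vec d) volume Ω p 6
  refine ⟨A * ((d ^ 2 : ℕ) * ((volume Ω) ^ e).toNNReal), fun φ hφ => ?_⟩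
  have hfin : ((volume Ω ^ e).toNNReal : ENNReal) = volume Ω ^ e :=
    ENNReal.coe_toNNReal (ENNReal.rpow_ne_top_of_nonneg he hvol)
  have hsupp : (jacobian φ).support ⊆ Ω := by
    refine Set.Subset.trans (fun x hx => ?_) ((support_fderiv_subset ℝ).trans hφ.2.2)
    rw [Function.mem_support] at hx ⊢
    contrapose! hx
    ext ij
    simp [jacobian, partialD, hx]
  calc eLpNorm φ 6 μ ≤ eLpNorm φ (6 : NNReal) volume :=
        eLpNorm_mono_measure _ Measure.restrict_le_self
    _ ≤ A * eLpNorm (fderiv ℝ φ) p volume :=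
        eLpNorm_le_eLpNorm_fderiv_of_le volume (hφ.1.of_le (by simp))
          ((subset_tsupport φ).trans hφ.2.2) hp1 (by simpa using hpd) (by simpa using hp6) hΩb
    _ ≤ A * ((d ^ 2 : ℕ) * eLpNorm (jacobian φ) p volume) := by
        gcongr
        have := eLpNorm_le_nnreal_smul_eLpNorm_of_ae_le_mul (μ := volume)
          (c := ((d ^ 2 : ℕ) : NNReal)) (f := fderiv ℝ φ) (g := jacobian φ)
          (Filter.Eventually.of_forall fun x => by exact_mod_cast norm_fderiv_le_jacobian φ x) p
        simpa [ENNReal.smul_def] using this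
    _ = A * ((d ^ 2 : ℕ) * eLpNorm (jacobian φ) p μ) := by
        rw [eLpNorm_restrict_eq_of_support_subset hsupp]
    _ ≤ A * ((d ^ 2 : ℕ) * (eLpNorm (jacobian φ) 2 μ * volume Ω ^ e)) := by
        gcongr
        have := eLpNorm_le_eLpNorm_mul_rpow_measure_univ (μ := μ) (p := p) (q := 2)
          (by exact_mod_cast hp2) hφ.continuous_jacobian.aestronglyMeasurable
        simpa [μ, e] using this
    _ = _ := by
        push_cast
        rw [hfin]
        ring

/-- The Sobolev inequality on `H¹₀(Ω)^d`. -/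
lemma exists_eLpNorm_six_le {d : ℕ} (hd : d = 2 ∨ d = 3) {Ω : Set (Vec d)}
    (hΩb : Bornology.IsBounded Ω) :
    ∃ S : NNReal, ∀ u : H10 Ω,
      eLpNorm (val u) 6 (volume.restrict Ω) ≤ S * ENNReal.ofReal ‖grad u‖ := by
  obtain ⟨S, hS⟩ := exists_eLpNorm_six_le_of_isTest hd hΩb
  refine ⟨S, fun u => ?_⟩
  set μ := volume.restrict Ω
  have hu : (u : L2Pair Ω) ∈ closure (testPairs Ω : Set (L2Pair Ω)) := u.2.2
  obtain ⟨a, ha, hlim⟩ := mem_closure_iff_seq_limit.1 hu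
  have h1 : Filter.Tendsto (fun n => (a n).fst) Filter.atTop (nhds (val u)) :=
    (WithLp.continuous_fst 2 _ _).continuousAt.tendsto.comp hlim
  have h2 : Filter.Tendsto (fun n => (a n).snd) Filter.atTop (nhds (grad u)) :=
    (WithLp.continuous_snd 2 _ _).continuousAt.tendsto.comp hlim
  -- `L²` convergence gives no `L⁶` convergence, but an a.e. convergent subsequence suffices: by
  -- Fatou the `L⁶` norm is lower semicontinuous along it.
  obtain ⟨ns, hns, hae⟩ := (tendstoInMeasure_of_tendsto_Lp h1).exists_seq_tendsto_ae
  have hb : ∀ n, eLpNorm ((a n).fst) 6 μ ≤ S * ENNReal.ofReal ‖(a n).snd‖ := by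
    intro n
    obtain ⟨φ, hφ, e1, e2⟩ := ha n
    rw [eLpNorm_congr_ae e1, Lp.norm_def, ENNReal.ofReal_toReal (Lp.eLpNorm_ne_top _),
      eLpNorm_congr_ae e2]
    exact hS φ hφ
  have h3 : Filter.Tendsto (fun n => (S : ENNReal) * ENNReal.ofReal ‖(a (ns n)).snd‖) Filter.atTop
      (nhds (S * ENNReal.ofReal ‖grad u‖)) :=
    ENNReal.Tendsto.const_mul (ENNReal.tendsto_ofReal (h2.comp hns.tendsto_atTop).norm)
      (Or.inr ENNReal.coe_ne_top)
  refine (Lp.eLpNorm_lim_le_liminf_eLpNorm (fun n => (Lp.aestronglyMeasurable (a (ns n)).fst)) _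
    hae).trans ?_
  rw [← h3.liminf_eq]
  exact Filter.liminf_le_liminf (Filter.Eventually.of_forall fun n => hb _)

/-- The Poincaré inequality on `H¹₀(Ω)^d`. -/
lemma exists_norm_val_le {d : ℕ} (hd : d = 2 ∨ d = 3) {Ω : Set (Vec d)}
    (hΩb : Bornology.IsBounded Ω) : ∃ C : ℝ, 0 ≤ C ∧ ∀ u : H10 Ω, ‖val u‖ ≤ C * ‖grad u‖ := by
  obtain ⟨S, hS⟩ := exists_eLpNorm_six_le hd hΩb
  have hvol : volume Ω ≠ ⊤ := hΩb.measure_lt_top.ne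
  refine ⟨S * (volume Ω ^ (1 / (2 : ENNReal).toReal - 1 / (6 : ENNReal).toReal)).toReal,
    by positivity, fun u => ?_⟩
  have h := eLpNorm_le_eLpNorm_mul_rpow_measure_univ (μ := volume.restrict Ω) (p := 2) (q := 6)
    (by norm_num) (Lp.aestronglyMeasurable (val u))
  rw [Measure.restrict_apply_univ] at h
  have h' := h.trans (mul_le_mul_left (hS u) _)
  rw [Lp.norm_def]
  refine (ENNReal.toReal_mono ?_ h').trans ?_
  · exact ENNReal.mul_ne_top (ENNReal.mul_ne_top ENNReal.coe_ne_top ENNReal.ofReal_ne_top)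
      (ENNReal.rpow_ne_top_of_nonneg (by norm_num) hvol)
  · simp only [ENNReal.toReal_mul, ENNReal.coe_toReal, ENNReal.toReal_ofReal (norm_nonneg _)]
    apply le_of_eq
    ring

lemma norm_sq_eq {d : ℕ} {Ω : Set (Vec d)} (u : H10 Ω) :
    ‖u‖ ^ 2 = ‖val u‖ ^ 2 + ‖grad u‖ ^ 2 :=
  WithLp.prod_norm_sq_eq_of_L2 (u : L2Pair Ω)

lemma apply_le_normNegOne_mul {d : ℕ} (hd : d = 2 ∨ d = 3) {Ω : Set (Vec d)}
    (hΩb : Bornology.IsBounded Ω) (f : H10 Ω →L[ℝ] ℝ) (v : H10 Ω) :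
    |f v| ≤ normNegOne f * ‖grad v‖ := by
  obtain ⟨C, hC, h⟩ := exists_norm_val_le hd hΩb
  have hv : ∀ v : H10 Ω, |f v| ≤ ‖f‖ * (C + 1) * ‖grad v‖ := by
    intro v
    have h1 : ‖v‖ ≤ (C + 1) * ‖grad v‖ := by
      refine abs_le_of_sq_le_sq' ?_ (by positivity) |>.2
      rw [norm_sq_eq]
      have := pow_le_pow_left₀ (norm_nonneg _) (h v) 2
      nlinarith [mul_nonneg hC (sq_nonneg ‖grad v‖)]
    calc |f v| ≤ ‖f‖ * ‖v‖ := f.le_opNorm v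
      _ ≤ _ := by rw [mul_assoc]; gcongr
  -- A real supremum is informative only over a bounded set; the Poincaré inequality supplies the
  -- bound `hv`, which also settles the case of zero gradient, where the quotient carries no
  -- information.
  by_cases h0 : ‖grad v‖ = 0
  · have := hv v
    rw [h0] at this ⊢
    simpa using this
  · have hb : BddAbove (Set.range fun v : H10 Ω => |f v| / ‖grad v‖) := by
      refine ⟨‖f‖ * (C + 1), ?_⟩
      rintro _ ⟨v, rfl⟩
      exact div_le_of_le_mul₀ (norm_nonneg _) (by positivity) (hv v)
    rw [← div_le_iff₀ (lt_of_le_of_ne (norm_nonneg _) (Ne.symm h0))]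
    exact le_ciSup hb v

/-! ### Inverse inequality for polynomials on balls. -/

lemma totalDegree_bind₁_le {ι : Type} (g : ι → MvPolynomial ι ℝ)
    (hg : ∀ i, (g i).totalDegree ≤ 1) (p : MvPolynomial ι ℝ) :
    (MvPolynomial.bind₁ g p).totalDegree ≤ p.totalDegree := by
  classical
  conv_lhs => rw [p.as_sum, map_sum]
  refine MvPolynomial.totalDegree_finsetSum_le fun m hm => ?_
  rw [MvPolynomial.bind₁_monomial]
  refine (MvPolynomial.totalDegree_mul _ _).trans ?_
  rw [MvPolynomial.totalDegree_C, zero_add]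
  refine (MvPolynomial.totalDegree_finsetProd _ _).trans ?_
  refine le_trans (Finset.sum_le_sum fun i _ => ?_) (MvPolynomial.le_totalDegree hm)
  exact (MvPolynomial.totalDegree_pow _ _).trans (mul_le_of_le_one_right (Nat.zero_le _) (hg i))

/-- The values of a polynomial as a function on `ℝ^d`. -/
noncomputable def polyFun {d : ℕ} (p : MvPolynomial (Fin d) ℝ) (x : Vec d) : ℝ :=
  MvPolynomial.eval (fun m => x m) p

lemma continuous_polyFun {d : ℕ} (p : MvPolynomial (Fin d) ℝ) : Continuous (polyFun p) :=
  (MvPolynomial.continuous_eval p).comp (continuous_pi fun m =>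
    (EuclideanSpace.proj (𝕜 := ℝ) m).continuous)

lemma memLp_polyFun {d : ℕ} (p : MvPolynomial (Fin d) ℝ) {s : Set (Vec d)}
    (hs : Bornology.IsBounded s) (q : ENNReal) : MemLp (polyFun p) q (volume.restrict s) := by
  have h : MemLp (polyFun p) q (volume.restrict (closure s)) := by
    obtain ⟨B, hB⟩ := hs.isCompact_closure.exists_bound_of_continuousOn
      (continuous_polyFun p).continuousOn
    have : IsFiniteMeasure (volume.restrict (closure s)) :=
      ⟨by simpa using hs.isCompact_closure.measure_lt_top⟩
    refine MemLp.of_bound (continuous_polyFun p).aestronglyMeasurable B ?_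
    filter_upwards [ae_restrict_mem isClosed_closure.measurableSet] with x hx using hB x hx
  exact h.mono_measure (Measure.restrict_mono subset_closure le_rfl)

lemma eq_zero_of_polyFun_ae_eq_zero {d : ℕ} {r : ℝ} (hr : 0 < r) (p : MvPolynomial (Fin d) ℝ)
    (h : polyFun p =ᵐ[volume.restrict (Metric.ball (0 : Vec d) r)] 0) : p = 0 := by
  have h0 : Set.EqOn (polyFun p) 0 (Metric.ball (0 : Vec d) r) :=
    Measure.eqOn_open_of_ae_eq h Metric.isOpen_ball (continuous_polyFun p).continuousOn
      continuousOn_const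
  -- The cube of half-width `δ` lies in the ball, since its points have `ℓ¹` norm at most `d δ < r`.
  -- A polynomial vanishing on a product of infinite sets is zero.
  set δ : ℝ := r / (d + 1)
  have hδ : 0 < δ := by positivity
  refine MvPolynomial.funext_set (fun _ => Set.Ioo (-δ) δ)
    (fun _ => Set.Ioo_infinite (by linarith)) fun x hx => ?_
  have hx' : ∀ i, |x i| ≤ δ := fun i => (abs_lt.2 (hx i (Set.mem_univ i))).le
  have hb : WithLp.toLp 2 x ∈ Metric.ball (0 : Vec d) r := by
    rw [mem_ball_zero_iff]
    calc ‖WithLp.toLp 2 x‖ ≤ ∑ i, |x i| := norm_le_sum_abs (WithLp.toLp 2 x)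
      _ ≤ ∑ _i : Fin d, δ := Finset.sum_le_sum fun i _ => hx' i
      _ = d * δ := by simp
      _ < (d + 1) * δ := by linarith
      _ = r := by simp only [δ]; field_simp
  simpa [polyFun] using h0 hb

/-- The `L²` norm on a ball controls the maximum norm on the unit ball, for polynomials. -/
lemma exists_polyFun_le_unit (d k : ℕ) {r : ℝ} (hr : 0 < r) :
    ∃ C : ℝ, 0 ≤ C ∧ ∀ p : MvPolynomial (Fin d) ℝ, p.totalDegree ≤ k →
      ∀ x ∈ Metric.closedBall (0 : Vec d) 1,
        polyFun p x ^ 2 ≤ C * ∫ y in Metric.ball (0 : Vec d) r, polyFun p y ^ 2 := by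
  set V := MvPolynomial.restrictTotalDegree (Fin d) ℝ k
  set B := Metric.closedBall (0 : Vec d) 1
  set μ := volume.restrict (Metric.ball (0 : Vec d) r)
  have hm : ∀ p, MemLp (polyFun (d := d) p) 2 μ := fun p => memLp_polyFun p Metric.isBounded_ball 2
  let A : V →ₗ[ℝ] Lp ℝ 2 μ :=
    { toFun := fun p => (hm p.1).toLp _
      map_add' := fun p q => by
        rw [← MemLp.toLp_add]
        congr 1
        ext x
        simp [polyFun]
      map_smul' := fun c p => by
        rw [RingHom.id_apply, ← MemLp.toLp_const_smul]
        congr 1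
        ext x
        simp [polyFun, MvPolynomial.smul_eval] }
  have hA : Function.Injective A := by
    rw [← LinearMap.ker_eq_bot, LinearMap.ker_eq_bot']
    intro p hp
    apply Subtype.ext
    refine eq_zero_of_polyFun_ae_eq_zero hr p.1 ?_
    have h1 := (hm p.1).coeFn_toLp
    have h2 : (hm p.1).toLp _ = 0 := hp
    rw [h2] at h1
    exact h1.symm.trans (Lp.coeFn_zero _ _ _)
  have : CompactSpace B := isCompact_iff_compactSpace.1 (isCompact_closedBall _ _)
  let E : V →ₗ[ℝ] C(B, ℝ) :=
    { toFun := fun p => ⟨fun x => polyFun p.1 x.1,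
        (continuous_polyFun p.1).comp continuous_subtype_val⟩
      map_add' := fun p q => by
        ext x
        simp [polyFun]
      map_smul' := fun c p => by
        ext x
        simp [polyFun, MvPolynomial.smul_eval] }
  let e := LinearEquiv.ofInjective A hA
  have : FiniteDimensional ℝ V := inferInstance
  have : FiniteDimensional ℝ (LinearMap.range A) := inferInstance
  -- The `L²` class determines the polynomial, so restriction to the unit ball is a linear map on a
  -- finite-dimensional subspace of `L²`, hence bounded.
  let T := LinearMap.toContinuousLinearMap (E ∘ₗ e.symm.toLinearMap)
  refine ⟨‖T‖ ^ 2, by positivity, fun p hp x hx => ?_⟩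
  let P : V := ⟨p, (MvPolynomial.mem_restrictTotalDegree _ _ _).2 hp⟩
  have h1 : ‖E P‖ ≤ ‖T‖ * ‖A P‖ := by
    have := T.le_opNorm (e P)
    simpa [T, e] using this
  have h2 : |polyFun p x| ≤ ‖E P‖ := (E P).norm_coe_le_norm ⟨x, hx⟩
  have h3 : ‖A P‖ ^ 2 = ∫ y in Metric.ball (0 : Vec d) r, polyFun p y ^ 2 := by
    rw [← real_inner_self_eq_norm_sq, L2.inner_def]
    apply integral_congr_ae
    filter_upwards [(hm p).coeFn_toLp] with y hy
    change inner ℝ ((hm p).toLp _ y) ((hm p).toLp _ y) = _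
    rw [hy]
    simp [pow_two]
  rw [← h3, ← mul_pow, ← sq_abs]
  exact pow_le_pow_left₀ (abs_nonneg _) (h2.trans h1) 2

/-- Scaled version of `exists_polyFun_le_unit`. -/
lemma exists_polyFun_le (d k : ℕ) {r : ℝ} (hr : 0 < r) :
    ∃ C : ℝ, 0 ≤ C ∧ ∀ p : MvPolynomial (Fin d) ℝ, p.totalDegree ≤ k →
      ∀ (c : Vec d) (h : ℝ), 0 < h → ∀ x ∈ Metric.closedBall c h,
        polyFun p x ^ 2 ≤ C * (h ^ d)⁻¹ * ∫ y in Metric.ball c (r * h), polyFun p y ^ 2 := by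
  obtain ⟨C, hC, H⟩ := exists_polyFun_le_unit d k hr
  refine ⟨C, hC, fun p hp c h hh x hx => ?_⟩
  -- The substitution `y ↦ c + h y`; being affine, it does not raise the degree.
  let g : Fin d → MvPolynomial (Fin d) ℝ := fun i =>
    MvPolynomial.C (c i) + MvPolynomial.C h * MvPolynomial.X i
  have hg : ∀ i, (g i).totalDegree ≤ 1 := fun i => by
    refine (MvPolynomial.totalDegree_add _ _).trans (max_le (by simp) ?_)
    refine (MvPolynomial.totalDegree_mul _ _).trans ?_
    simp
  have hcomp : ∀ y, polyFun (MvPolynomial.bind₁ g p) y = polyFun p (c + h • y) := by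
    intro y
    simp only [polyFun, MvPolynomial.eval, MvPolynomial.eval₂Hom_bind₁]
    congr 2
    ext i
    simp [g]
  have hy : h⁻¹ • (x - c) ∈ Metric.closedBall (0 : Vec d) 1 := by
    rw [mem_closedBall_zero_iff, norm_smul, Real.norm_eq_abs, abs_of_pos (inv_pos.2 hh),
      inv_mul_le_iff₀ hh, mul_one, ← dist_eq_norm]
    exact hx
  have h1 := H _ ((totalDegree_bind₁_le g hg p).trans hp) _ hy
  rw [hcomp, smul_inv_smul₀ hh.ne', add_sub_cancel] at h1
  refine h1.trans (le_of_eq ?_)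
  rw [mul_assoc]
  congr 1
  let F : Vec d → ℝ := (Metric.ball c (r * h)).indicator fun y => polyFun p y ^ 2
  have hF : ∀ y, (Metric.ball (0 : Vec d) r).indicator
      (fun y => polyFun (MvPolynomial.bind₁ g p) y ^ 2) y = F (c + h • y) := by
    intro y
    have hiff : y ∈ Metric.ball (0 : Vec d) r ↔ c + h • y ∈ Metric.ball c (r * h) := by
      rw [mem_ball_zero_iff, mem_ball_iff_norm, add_sub_cancel_left, norm_smul, Real.norm_eq_abs,
        abs_of_pos hh, mul_comm r h, mul_lt_mul_iff_right₀ hh]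
    by_cases hb : y ∈ Metric.ball (0 : Vec d) r
    · rw [Set.indicator_of_mem hb]
      simp only [F]
      rw [Set.indicator_of_mem (hiff.1 hb), hcomp]
    · rw [Set.indicator_of_notMem hb]
      simp only [F]
      rw [Set.indicator_of_notMem (fun h' => hb (hiff.2 h'))]
  rw [← integral_indicator Metric.isOpen_ball.measurableSet,
    ← integral_indicator Metric.isOpen_ball.measurableSet]
  simp only [hF]
  -- The factor `h^{-d}` is the Jacobian of the dilation.
  rw [Measure.integral_comp_smul_of_nonneg volume (fun y => F (c + y)) h (hR := hh.le),
    integral_add_left_eq_self F c]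
  simp [F]

/-! ### Mesh geometry and the sup-norm inverse inequality on the finite element space. -/

lemma Mesh.diam_le_size {d : ℕ} {Ω : Set (Vec d)} (T : Mesh Ω) {K : Set (Vec d)}
    (hK : K ∈ T.cells) : Metric.diam K ≤ T.size :=
  le_ciSup (f := fun K : T.cells => Metric.diam K.1) (Set.finite_range _).bddAbove ⟨K, hK⟩

lemma Mesh.size_pos {d : ℕ} (hd : d ≠ 0) {Ω : Set (Vec d)} (T : Mesh Ω) {K : Set (Vec d)}
    (hK : K ∈ T.cells) : 0 < T.size := by
  refine lt_of_lt_of_le ?_ (T.diam_le_size hK)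
  obtain ⟨x, hx⟩ := T.interior_nonempty K hK
  have : Nonempty (Fin d) := ⟨⟨0, Nat.pos_of_ne_zero hd⟩⟩
  have : Nontrivial (Vec d) := inferInstance
  have hn : K.Nontrivial :=
    (infinite_of_mem_nhds x (mem_interior_iff_mem_nhds.1 hx)).nontrivial
  exact Metric.diam_pos hn (T.compact K hK).isBounded

/-- Only the interior of a cell is assumed to lie in `Ω`, but a compact convex set with nonempty
interior is the closure of that interior, so both have the same diameter. -/
lemma Mesh.size_le {d : ℕ} {Ω : Set (Vec d)} (hΩb : Bornology.IsBounded Ω) (T : Mesh Ω) :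
    T.size ≤ Metric.diam Ω := by
  refine Real.iSup_le (fun K => ?_) Metric.diam_nonneg
  obtain ⟨K, hK⟩ := K
  have h := (T.convex K hK).closure_interior_eq_closure_of_nonempty_interior
    (T.interior_nonempty K hK)
  rw [(T.compact K hK).isClosed.closure_eq] at h
  change Metric.diam K ≤ _
  rw [← h, Metric.diam_closure]
  exact Metric.diam_mono (T.interior_subset K hK) hΩb

/-- The points of `Ω` on the boundaries of the cells are negligible. -/
lemma Mesh.ae_mem {d : ℕ} {Ω : Set (Vec d)} (hΩ : IsOpen Ω) (T : Mesh Ω) (P : Vec d → Prop)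
    (h1 : ∀ K ∈ T.cells, ∀ᵐ x ∂(volume.restrict (interior K)), P x)
    (h2 : ∀ᵐ x ∂(volume.restrict (Ω \ ⋃ K ∈ T.cells, K)), P x) :
    ∀ᵐ x ∂(volume.restrict Ω), P x := by
  have h1' : ∀ K ∈ T.cells, ∀ᵐ x, x ∈ K → P x := by
    intro K hK
    have a := (ae_restrict_iff' isOpen_interior.measurableSet).1 (h1 K hK)
    have b : ∀ᵐ x, x ∉ frontier K :=
      measure_eq_zero_iff_ae_notMem.1 ((T.convex K hK).addHaar_frontier volume)
    filter_upwards [a, b] with x ha hb hx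
    refine ha (by_contra fun hi => hb ⟨subset_closure hx, hi⟩)
  have hm : MeasurableSet (Ω \ ⋃ K ∈ T.cells, K) :=
    hΩ.measurableSet.diff (Finset.measurableSet_biUnion _ fun K hK =>
      (T.compact K hK).isClosed.measurableSet)
  have h2' := (ae_restrict_iff' hm).1 h2
  have h3 : ∀ᵐ x, ∀ K ∈ T.cells, x ∈ K → P x :=
    (ae_ball_iff T.cells.countable_toSet).2 h1'
  rw [ae_restrict_iff' hΩ.measurableSet]
  filter_upwards [h2', h3] with x a b hx
  by_cases h : x ∈ ⋃ K ∈ T.cells, K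
  · simp only [Set.mem_iUnion, exists_prop] at h
    obtain ⟨K, hK, hxK⟩ := h
    exact b K hK hxK
  · exact a ⟨hx, h⟩

/-- Inverse inequality between the maximum norm and the `L²` norm. -/
lemma exists_sq_norm_le {d : ℕ} (hd : d ≠ 0) {Ω : Set (Vec d)} (hΩ : IsOpen Ω) (k : ℕ) {σ : ℝ}
    (hσ : 0 < σ) :
    ∃ C : ℝ, 0 ≤ C ∧ ∀ T : Mesh Ω, T.QuasiUniform σ → ∀ Xh : Submodule ℝ (H10 Ω),
      IsFEVelocitySpace T k Xh → ∀ v ∈ Xh, ∀ᵐ x ∂(volume.restrict Ω),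
        ‖val v x‖ ^ 2 ≤ C * (T.size ^ d)⁻¹ * ‖val v‖ ^ 2 := by
  obtain ⟨C, hC, H⟩ := exists_polyFun_le d k hσ
  refine ⟨d * C, by positivity, fun T hT Xh hX v hv => ?_⟩
  obtain ⟨hp, hz⟩ := hX v hv
  have hs : 0 ≤ T.size := Real.iSup_nonneg fun K => Metric.diam_nonneg
  refine T.ae_mem hΩ _ (fun K hK => ?_) ?_
  · obtain ⟨p, hpk, hpv⟩ := hp K hK
    obtain ⟨c, hc⟩ := hT K hK
    have hpos := T.size_pos hd hK
    -- The inscribed ball lies in the interior, where the field is polynomial, while the cell lies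
    -- in the ball of radius `h` about the same centre: this is the setting of `exists_polyFun_le`.
    have hcK : Metric.ball c (σ * T.size) ⊆ interior K :=
      interior_maximal hc Metric.isOpen_ball
    have hcmem : c ∈ K := hc (Metric.mem_ball_self (by positivity))
    have hi : ∀ i, ∫ y in Metric.ball c (σ * T.size), polyFun (p i) y ^ 2 ≤ ‖val v‖ ^ 2 := by
      intro i
      have hint : Integrable (fun x => ‖val v x‖ ^ 2) (volume.restrict Ω) :=
        (Lp.memLp (val v)).integrable_norm_pow (by norm_num)
      calc ∫ y in Metric.ball c (σ * T.size), polyFun (p i) y ^ 2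
          = ∫ y in Metric.ball c (σ * T.size), (val v y i) ^ 2 := by
            apply integral_congr_ae
            filter_upwards [ae_restrict_of_ae_restrict_of_subset hcK hpv] with y hy
            rw [hy i]
            rfl
        _ ≤ ∫ y in Ω, (val v y i) ^ 2 :=
            setIntegral_mono_set ((memLp_coord (val v) i).integrable_sq)
              (Filter.Eventually.of_forall fun _ => sq_nonneg _)
              (Filter.Eventually.of_forall (hcK.trans (T.interior_subset K hK)))
        _ ≤ ∫ y in Ω, ‖val v y‖ ^ 2 := by
            refine integral_mono ((memLp_coord (val v) i).integrable_sq) hint fun y => ?_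
            dsimp only
            rw [← sq_abs (val v y i)]
            exact pow_le_pow_left₀ (abs_nonneg _) (abs_apply_le_norm _ i) 2
        _ = ‖val v‖ ^ 2 := by
            rw [← real_inner_self_eq_norm_sq, L2.inner_def]
            simp only [real_inner_self_eq_norm_sq]
    filter_upwards [hpv, ae_restrict_mem isOpen_interior.measurableSet] with x hx hxK
    have hxc : x ∈ Metric.closedBall c T.size :=
      (Metric.dist_le_diam_of_mem (T.compact K hK).isBounded (interior_subset hxK) hcmem).trans
        (T.diam_le_size hK)
    rw [EuclideanSpace.norm_sq_eq]
    calc ∑ i, ‖val v x i‖ ^ 2 ≤ ∑ _i : Fin d, C * (T.size ^ d)⁻¹ * ‖val v‖ ^ 2 := by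
          refine Finset.sum_le_sum fun i _ => ?_
          rw [hx i, Real.norm_eq_abs, sq_abs]
          exact (H (p i) (hpk i) c _ hpos x hxc).trans
            (mul_le_mul_of_nonneg_left (hi i) (by positivity))
      _ = _ := by
          simp
          ring
  · filter_upwards [hz] with x hx
    rw [hx]
    simp
    positivity

/-! ### Integration by parts in the convective form. -/

lemma continuous_integral_coord_mul {d : ℕ} {Ω : Set (Vec d)} {ι : Type} [Fintype ι] (i : ι)
    {g : Vec d → ℝ} (hg : MemLp g 2 (volume.restrict Ω)) :
    Continuous fun u : L2 Ω (EuclideanSpace ℝ ι) => ∫ x in Ω, u x i * g x := by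
  have h : (fun u : L2 Ω (EuclideanSpace ℝ ι) => ∫ x in Ω, u x i * g x) = fun u =>
      inner ℝ (hg.toLp g)
        ((EuclideanSpace.proj (𝕜 := ℝ) i).compLpL 2 (volume.restrict Ω) u) := by
    ext u
    rw [L2.inner_def]
    apply integral_congr_ae
    filter_upwards [hg.coeFn_toLp,
      (EuclideanSpace.proj (𝕜 := ℝ) i).coeFn_compLpL u] with x h1 h2
    rw [h1, h2]
    simp
  rw [h]
  exact continuous_const.inner (ContinuousLinearMap.continuous _)

/-- The integral is `L²`-continuous in the pair (field, gradient), so its zero set is closed. This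
is how density of `C_c^∞` enters the integration by parts. -/
lemma integral_eq_zero_of_mem_closure {d : ℕ} {Ω : Set (Vec d)} (i : Fin d) (ij : Fin d × Fin d)
    {g₁ g₂ : Vec d → ℝ} (h₁ : MemLp g₁ 2 (volume.restrict Ω)) (h₂ : MemLp g₂ 2 (volume.restrict Ω))
    (H : ∀ a ∈ testPairs Ω, ∫ x in Ω, (a.fst x i * g₁ x + a.snd x ij * g₂ x) = 0)
    (a : L2Pair Ω) (ha : a ∈ (testPairs Ω).topologicalClosure) :
    ∫ x in Ω, (a.fst x i * g₁ x + a.snd x ij * g₂ x) = 0 := by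
  have e : (fun a : L2Pair Ω => ∫ x in Ω, (a.fst x i * g₁ x + a.snd x ij * g₂ x)) = fun a =>
      (∫ x in Ω, a.fst x i * g₁ x) + ∫ x in Ω, a.snd x ij * g₂ x := by
    ext a
    exact integral_add ((memLp_coord a.fst i).integrable_mul h₁)
      ((memLp_coord a.snd ij).integrable_mul h₂)
  have hc : Continuous
      fun a : L2Pair Ω => ∫ x in Ω, (a.fst x i * g₁ x + a.snd x ij * g₂ x) := by
    rw [e]
    exact ((continuous_integral_coord_mul i h₁).comp (WithLp.continuous_fst 2 _ _)).add
      ((continuous_integral_coord_mul ij h₂).comp (WithLp.continuous_snd 2 _ _))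
  exact closure_minimal (t := {a | ∫ x in Ω, (a.fst x i * g₁ x + a.snd x ij * g₂ x) = 0})
    (s := (testPairs Ω : Set (L2Pair Ω))) (fun a ha => H a ha) (isClosed_eq hc continuous_const) ha

lemma partialD_mul {d : ℕ} {φ ψ : Vec d → Vec d} (hφ : ContDiff ℝ ∞ φ) (hψ : ContDiff ℝ ∞ ψ)
    (i j : Fin d) (x : Vec d) :
    partialD j (fun x => φ x j * ψ x i) x
      = jacobian φ x (j, j) * ψ x i + φ x j * jacobian ψ x (i, j) := by
  have key : ∀ {φ : Vec d → Vec d}, ContDiff ℝ ∞ φ → ∀ i,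
      HasFDerivAt (fun x => φ x i) ((EuclideanSpace.proj (𝕜 := ℝ) i).comp (fderiv ℝ φ x)) x := by
    intro φ hφ i
    exact (EuclideanSpace.proj (𝕜 := ℝ) i).hasFDerivAt.comp x
      ((hφ.differentiable (by simp)) x).hasFDerivAt
  have h := (key hφ j).mul (key hψ i)
  change fderiv ℝ ((fun x => φ x j) * fun x => ψ x i) x _ = _
  rw [h.fderiv]
  simp [jacobian, partialD]
  ring

lemma IsTest.coord_mul {d : ℕ} {Ω : Set (Vec d)} {φ ψ : Vec d → Vec d} (hφ : IsTest Ω φ)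
    (hψ : IsTest Ω ψ) (i j : Fin d) : IsTest Ω (fun x => φ x j * ψ x i) := by
  have h1 : ∀ {φ : Vec d → Vec d}, ContDiff ℝ ∞ φ → ∀ i, ContDiff ℝ ∞ fun x => φ x i :=
    fun h i => (EuclideanSpace.proj (𝕜 := ℝ) i).contDiff.comp h
  have hs : Function.support (fun x => φ x j * ψ x i) ⊆ Function.support φ := by
    intro x hx h0
    apply hx
    simp [h0]
  exact ⟨(h1 hφ.1 j).mul (h1 hψ.1 i), hφ.2.1.mono hs, (closure_mono hs).trans hφ.2.2⟩

lemma IsTest.memLp_top_coord {d : ℕ} {Ω : Set (Vec d)} {φ : Vec d → Vec d} (hφ : IsTest Ω φ)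
    (i : Fin d) : MemLp (fun x => φ x i) ⊤ (volume.restrict Ω) :=
  ((EuclideanSpace.proj (𝕜 := ℝ) i).comp_memLp'
    (hφ.1.continuous.memLp_top_of_hasCompactSupport hφ.2.1 volume)).restrict Ω

lemma IsTest.memLp_top_jacobian {d : ℕ} {Ω : Set (Vec d)} {φ : Vec d → Vec d} (hφ : IsTest Ω φ)
    (ij : Fin d × Fin d) : MemLp (fun x => jacobian φ x ij) ⊤ (volume.restrict Ω) := by
  have hs : HasCompactSupport (jacobian φ) := by
    refine (hφ.2.1.fderiv ℝ).mono fun x hx h0 => hx ?_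
    ext ij
    simp [jacobian, partialD, h0]
  exact ((EuclideanSpace.proj (𝕜 := ℝ) ij).comp_memLp'
    (hφ.continuous_jacobian.memLp_top_of_hasCompactSupport hs volume)).restrict Ω

lemma memLp_top_mul {α : Type*} {m : MeasurableSpace α} {μ : Measure α} {f g : α → ℝ}
    (hf : MemLp f ⊤ μ) (hg : MemLp g 2 μ) : MemLp (fun x => f x * g x) 2 μ :=
  MemLp.mul (p := ⊤) (q := 2) hg hf

lemma memLp_top_coord {d : ℕ} {Ω : Set (Vec d)} {u : H10 Ω}
    (hu : MemLp (val u) ⊤ (volume.restrict Ω)) (i : Fin d) :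
    MemLp (fun x => val u x i) ⊤ (volume.restrict Ω) :=
  (EuclideanSpace.proj (𝕜 := ℝ) i).comp_memLp' hu

/-- Integration by parts in a single pair of coordinates. -/
lemma integral_coord_by_parts {d : ℕ} {Ω : Set (Vec d)} (w u v : H10 Ω)
    (hw : MemLp (val w) ⊤ (volume.restrict Ω)) (hv : MemLp (val v) ⊤ (volume.restrict Ω))
    (i j : Fin d) :
    ∫ x in Ω, (val w x j * (grad u x (i, j) * val v x i + grad v x (i, j) * val u x i)
      + grad w x (j, j) * (val u x i * val v x i)) = 0 := by
  -- The fields are approximated one at a time, so each limit is linear with square integrable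
  -- coefficients. Here `u` is replaced by a smooth `ψ` and `a` stands for `w`; for smooth `a = φ`
  -- the identity is the definition of the weak gradient of `v`, tested with `φ_j ψ_i`.
  have h0 : ∀ ψ : Vec d → Vec d, IsTest Ω ψ → ∀ a ∈ (testPairs Ω).topologicalClosure,
      ∫ x in Ω, (a.fst x j * (jacobian ψ x (i, j) * val v x i + ψ x i * grad v x (i, j))
        + a.snd x (j, j) * (ψ x i * val v x i)) = 0 := by
    intro ψ hψ
    have m1 := memLp_top_mul (hψ.memLp_top_jacobian (i, j)) (memLp_coord (val v) i)
    have m2 := memLp_top_mul (hψ.memLp_top_coord i) (memLp_coord (grad v) (i, j))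
    have m3 := memLp_top_mul (hψ.memLp_top_coord i) (memLp_coord (val v) i)
    refine integral_eq_zero_of_mem_closure j (j, j) (m1.add m2) m3 ?_
    rintro a ⟨φ, hφ, e1, e2⟩
    have hH := v.2.1 _ (hφ.coord_mul hψ i j) i j
    have ht := hφ.coord_mul hψ i j
    have i1 : Integrable (fun x => val v x i * partialD j (fun x => φ x j * ψ x i) x)
        (volume.restrict Ω) := (memLp_coord (val v) i).integrable_mul (ht.memLp_partialD j)
    have i2 : Integrable (fun x => grad v x (i, j) * (φ x j * ψ x i)) (volume.restrict Ω) :=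
      (memLp_coord (grad v) (i, j)).integrable_mul ht.memLp
    rw [eq_neg_iff_add_eq_zero] at hH
    rw [← hH]
    refine Eq.trans ?_ (integral_add i1 i2)
    apply integral_congr_ae
    filter_upwards [e1, e2] with x h1 h2
    rw [h1, h2, partialD_mul hφ.1 hψ.1]
    simp only [val, grad]
    ring
  have m1 := memLp_top_mul (memLp_top_coord hw j) (memLp_coord (grad v) (i, j))
  have m2 := memLp_top_mul (memLp_top_coord hv i) (memLp_coord (grad w) (j, j))
  have m3 := memLp_top_mul (memLp_top_coord hw j) (memLp_coord (val v) i)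
  -- Second limit, `ψ → u`. Boundedness of `w` and `v` puts the coefficients of `u_i` and `∂_j u_i`
  -- in `L²`.
  refine Eq.trans ?_ (integral_eq_zero_of_mem_closure i (i, j) (m1.add m2) m3 ?_ u.1 u.2.2)
  · congr 1
    ext x
    simp only [Pi.add_apply, val, grad]
    ring
  · rintro a ⟨ψ, hψ, e1, e2⟩
    rw [← h0 ψ hψ w.1 w.2.2]
    apply integral_congr_ae
    filter_upwards [e1, e2] with x h1 h2
    rw [h1, h2]
    simp only [Pi.add_apply, val, grad]
    ring

lemma integrable_conv {d : ℕ} {Ω : Set (Vec d)} (u v w : H10 Ω)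
    (hu : MemLp (val u) ⊤ (volume.restrict Ω)) (i j : Fin d) :
    Integrable (fun x => val u x j * grad v x (i, j) * val w x i) (volume.restrict Ω) :=
  (memLp_top_mul (memLp_top_coord hu j) (memLp_coord (grad v) (i, j))).integrable_mul
    (memLp_coord (val w) i)

/-- `(w · ∇v, u) = - (w · ∇u, v) - ((∇ · w) u, v)`. -/
lemma conv_by_parts {d : ℕ} {Ω : Set (Vec d)} (w u v : H10 Ω)
    (hw : MemLp (val w) ⊤ (volume.restrict Ω)) (hv : MemLp (val v) ⊤ (volume.restrict Ω)) :
    conv w v u = - conv w u v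
      - ∫ x in Ω, ∑ i : Fin d, ∑ j : Fin d, val u x i * grad w x (j, j) * val v x i := by
  have i3 : ∀ i j : Fin d, Integrable (fun x => val u x i * grad w x (j, j) * val v x i)
      (volume.restrict Ω) := fun i j => by
    refine ((memLp_top_mul (memLp_top_coord hv i) (memLp_coord (grad w) (j, j))).integrable_mul
      (memLp_coord (val u) i)).congr (Filter.Eventually.of_forall fun x => ?_)
    simp only [Pi.mul_apply]
    ring
  unfold conv
  rw [integral_finsetSum _ fun i _ => integrable_finsetSum _ fun j _ => integrable_conv w v u hw i j,
    integral_finsetSum _ fun i _ => integrable_finsetSum _ fun j _ => integrable_conv w u v hw i j,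
    integral_finsetSum _ fun i _ => integrable_finsetSum _ fun j _ => i3 i j,
    ← Finset.sum_neg_distrib, ← Finset.sum_sub_distrib]
  refine Finset.sum_congr rfl fun i _ => ?_
  rw [integral_finsetSum _ fun j _ => integrable_conv w v u hw i j,
    integral_finsetSum _ fun j _ => integrable_conv w u v hw i j,
    integral_finsetSum _ fun j _ => i3 i j,
    ← Finset.sum_neg_distrib, ← Finset.sum_sub_distrib]
  refine Finset.sum_congr rfl fun j _ => ?_
  have h := integral_coord_by_parts w u v hw hv i j
  have e : ∫ x in Ω, (val w x j * (grad u x (i, j) * val v x i + grad v x (i, j) * val u x i)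
      + grad w x (j, j) * (val u x i * val v x i))
      = (∫ x in Ω, val w x j * grad u x (i, j) * val v x i)
        + (∫ x in Ω, val w x j * grad v x (i, j) * val u x i)
        + ∫ x in Ω, val u x i * grad w x (j, j) * val v x i := by
    rw [← integral_add (integrable_conv w u v hw i j) (integrable_conv w v u hw i j)]
    refine Eq.trans ?_ (integral_add
      ((integrable_conv w u v hw i j).add (integrable_conv w v u hw i j)) (i3 i j))
    congr 1
    ext x
    dsimp only
    ring
  linarith

/-! ### The bound on `b*` with the factor `h^{-1/2}`. -/

/-- Hölder's inequality with exponents `6`, `2`, `3`. -/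
lemma enorm_integral_le_of_abs_le {α E F G : Type*} {m : MeasurableSpace α} {μ : Measure α}
    [NormedAddCommGroup E] [NormedAddCommGroup F] [NormedAddCommGroup G]
    {a : α → E} {b : α → F} {c : α → G} {f : α → ℝ} (K : NNReal)
    (ha : AEStronglyMeasurable a μ) (hb : AEStronglyMeasurable b μ) (hc : AEStronglyMeasurable c μ)
    (hf : ∀ x, |f x| ≤ K * (‖a x‖ * ‖b x‖ * ‖c x‖)) :
    ‖∫ x, f x ∂μ‖ₑ ≤ K * (eLpNorm a 6 μ * eLpNorm b 2 μ * eLpNorm c 3 μ) := by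
  -- Hölder is applied twice: `1/6 + 1/3 = 1/2`, then `1/2 + 1/2 = 1`.
  have : ENNReal.HolderTriple 6 3 2 := ⟨by
    rw [← ENNReal.toReal_eq_toReal_iff' (by simp) (by simp),
      ENNReal.toReal_add (by simp) (by simp)]
    norm_num⟩
  have h1 : eLpNorm (fun x => ‖a x‖ * ‖c x‖) 2 μ ≤ eLpNorm a 6 μ * eLpNorm c 3 μ := by
    have := eLpNorm_le_eLpNorm_mul_eLpNorm'_of_norm (p := 6) (q := 3) (r := 2) ha hc
      (fun s t => ‖s‖ * ‖t‖) 1 (Filter.Eventually.of_forall fun x => by simp)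
    simpa using this
  have h2 : eLpNorm (fun x => ‖b x‖ * (‖a x‖ * ‖c x‖)) 1 μ
      ≤ eLpNorm b 2 μ * eLpNorm (fun x => ‖a x‖ * ‖c x‖) 2 μ := by
    have := eLpNorm_le_eLpNorm_mul_eLpNorm'_of_norm (p := 2) (q := 2) (r := 1)
      (g := fun x => ‖a x‖ * ‖c x‖) hb (ha.norm.mul hc.norm) (fun s t => ‖s‖ * t) 1 (Filter.Eventually.of_forall fun x => by simp)
    simpa using this
  calc ‖∫ x, f x ∂μ‖ₑ ≤ ∫⁻ x, ‖f x‖ₑ ∂μ := enorm_integral_le_lintegral_enorm _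
    _ = eLpNorm f 1 μ := eLpNorm_one_eq_lintegral_enorm.symm
    _ ≤ K * eLpNorm (fun x => ‖b x‖ * (‖a x‖ * ‖c x‖)) 1 μ := by
        have := eLpNorm_le_nnreal_smul_eLpNorm_of_ae_le_mul (μ := μ) (c := K) (f := f)
          (g := fun x => ‖b x‖ * (‖a x‖ * ‖c x‖)) (Filter.Eventually.of_forall fun x => by
            refine NNReal.coe_le_coe.1 ((hf x).trans (le_of_eq ?_))
            simp only [NNReal.coe_mul, coe_nnnorm, norm_mul, norm_norm]
            ring) 1
        simpa [ENNReal.smul_def] using this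
    _ ≤ K * (eLpNorm b 2 μ * (eLpNorm a 6 μ * eLpNorm c 3 μ)) := by
        gcongr
        exact h2.trans (by gcongr)
    _ = _ := by ring

lemma abs_sum_sum_le {d : ℕ} (t : Fin d → Fin d → ℝ) {B : ℝ} (h : ∀ i j, |t i j| ≤ B) :
    |∑ i, ∑ j, t i j| ≤ (d ^ 2 : ℕ) * B := by
  refine (Finset.abs_sum_le_sum_abs _ _).trans ((Finset.sum_le_sum fun i _ =>
    (Finset.abs_sum_le_sum_abs _ _).trans (Finset.sum_le_sum fun j _ => h i j)).trans
    (le_of_eq ?_))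
  simp
  ring

/-- Interpolation: the cube of the `L³` norm is at most the sup norm times the square of the `L²`
norm. Writing the sup bound with `A ^ 3` makes the cube root explicit. -/
lemma eLpNorm_three_le {α E : Type*} {m : MeasurableSpace α} {μ : Measure α}
    [NormedAddCommGroup E] (v : Lp E 2 μ) {A : ℝ} (hA : 0 ≤ A)
    (h : ∀ᵐ x ∂μ, ‖v x‖ ≤ A ^ 3 * ‖v‖) : eLpNorm v 3 μ ≤ ENNReal.ofReal (A * ‖v‖) := by
  have e2 : ∫⁻ x, ‖v x‖ₑ ^ 2 ∂μ = ENNReal.ofReal ‖v‖ ^ 2 := by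
    rw [Lp.norm_def, ENNReal.ofReal_toReal (Lp.eLpNorm_ne_top v)]
    have := eLpNorm_nnreal_pow_eq_lintegral (f := v) (μ := μ) (p := 2) (by norm_num)
    simpa using this.symm
  have e3 : eLpNorm v 3 μ ^ 3 = ∫⁻ x, ‖v x‖ₑ ^ 3 ∂μ := by
    have := eLpNorm_nnreal_pow_eq_lintegral (f := v) (μ := μ) (p := 3) (by norm_num)
    simpa using this
  refine (ENNReal.pow_le_pow_left_iff (n := 3) (by norm_num)).1 ?_
  rw [e3]
  calc ∫⁻ x, ‖v x‖ₑ ^ 3 ∂μ ≤ ∫⁻ x, ENNReal.ofReal (A ^ 3 * ‖v‖) * ‖v x‖ₑ ^ 2 ∂μ := by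
        refine lintegral_mono_ae ?_
        filter_upwards [h] with x hx
        rw [pow_succ' _ 2]
        gcongr
        rw [← ofReal_norm]
        exact ENNReal.ofReal_le_ofReal hx
    _ = ENNReal.ofReal (A * ‖v‖) ^ 3 := by
        rw [lintegral_const_mul' _ _ ENNReal.ofReal_ne_top, e2,
          ← ENNReal.ofReal_pow (norm_nonneg _), ← ENNReal.ofReal_mul (by positivity),
          ← ENNReal.ofReal_pow (by positivity)]
        congr 1
        ring

/-- The rate is `h^{-3/2}` in both dimensions, written as a cube to suit `eLpNorm_three_le`. -/
lemma exists_norm_le_of_mem {d : ℕ} (hd : d = 2 ∨ d = 3) {Ω : Set (Vec d)} (hΩ : IsOpen Ω)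
    (hΩb : Bornology.IsBounded Ω) (k : ℕ) {σ : ℝ} (hσ : 0 < σ) :
    ∃ A : ℝ, 0 ≤ A ∧ ∀ T : Mesh Ω, T.QuasiUniform σ → ∀ Xh : Submodule ℝ (H10 Ω),
      IsFEVelocitySpace T k Xh → ∀ v ∈ Xh, ∀ᵐ x ∂(volume.restrict Ω),
        ‖val v x‖ ≤ (A * (√T.size)⁻¹) ^ 3 * ‖val v‖ := by
  obtain ⟨C, hC, H⟩ := exists_sq_norm_le (by omega) hΩ k hσ
  -- For `d = 2` one power of `h` is traded for `diam Ω`, using `h ≤ diam Ω`.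
  obtain ⟨D, hD, hDT⟩ : ∃ D : ℝ, 0 ≤ D ∧ ∀ T : Mesh Ω,
      (T.size ^ d)⁻¹ ≤ D * (T.size ^ 3)⁻¹ := by
    rcases hd with rfl | rfl
    · refine ⟨Metric.diam Ω, Metric.diam_nonneg, fun T => ?_⟩
      have hs : 0 ≤ T.size := Real.iSup_nonneg fun K => Metric.diam_nonneg
      rcases hs.eq_or_lt with h | h
      · simp [← h]
      · have := T.size_le hΩb
        rw [← div_eq_mul_inv, le_div_iff₀ (by positivity)]
        refine le_trans (le_of_eq ?_) this
        field_simp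
    · exact ⟨1, zero_le_one, fun T => by simp⟩
  -- Since `C D ≤ (1 + C D)^6`, no sixth root is needed.
  refine ⟨1 + C * D, by positivity, fun T hT Xh hX v hv => ?_⟩
  have hs : 0 ≤ T.size := Real.iSup_nonneg fun K => Metric.diam_nonneg
  filter_upwards [H T hT Xh hX v hv] with x hx
  refine abs_le_of_sq_le_sq' ?_ (by positivity) |>.2
  have e : ((√T.size)⁻¹ ^ 3) ^ 2 = (T.size ^ 3)⁻¹ := by
    rw [inv_pow, inv_pow, ← pow_mul, mul_comm 3 2, pow_mul, Real.sq_sqrt hs]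
  have h0 : 0 ≤ C * D := by positivity
  have h1 : C * D ≤ ((1 + C * D) ^ 3) ^ 2 := by
    rw [← pow_mul]
    exact (by linarith : C * D ≤ 1 + C * D).trans (le_self_pow₀ (by linarith) (by norm_num))
  calc ‖val v x‖ ^ 2 ≤ C * (T.size ^ d)⁻¹ * ‖val v‖ ^ 2 := hx
    _ ≤ C * (D * (T.size ^ 3)⁻¹) * ‖val v‖ ^ 2 := by
        gcongr
        exact hDT T
    _ = C * D * ((T.size ^ 3)⁻¹ * ‖val v‖ ^ 2) := by ring
    _ ≤ ((1 + C * D) ^ 3) ^ 2 * ((T.size ^ 3)⁻¹ * ‖val v‖ ^ 2) := by gcongr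
    _ = _ := by
        rw [← e]
        ring

/-- Members of the finite element space are bounded. -/
lemma memLp_top_of_mem {d : ℕ} (hd : d = 2 ∨ d = 3) {Ω : Set (Vec d)} (hΩ : IsOpen Ω)
    (hΩb : Bornology.IsBounded Ω) {k : ℕ} {σ : ℝ} (hσ : 0 < σ) {T : Mesh Ω}
    (hT : T.QuasiUniform σ) {Xh : Submodule ℝ (H10 Ω)} (hX : IsFEVelocitySpace T k Xh)
    {v : H10 Ω} (hv : v ∈ Xh) : MemLp (val v) ⊤ (volume.restrict Ω) := by
  obtain ⟨A, -, H⟩ := exists_norm_le_of_mem hd hΩ hΩb k hσ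
  exact memLp_top_of_bound (Lp.aestronglyMeasurable _) _ (H T hT Xh hX v hv)

/-- The estimate `|b*(w, u, v)| ≤ K h^{-1/2} ‖∇w‖ ‖∇u‖ ‖v‖` on the finite element space. -/
lemma exists_abs_bStar_le {d : ℕ} (hd : d = 2 ∨ d = 3) {Ω : Set (Vec d)} (hΩ : IsOpen Ω)
    (hΩb : Bornology.IsBounded Ω) (k : ℕ) {σ : ℝ} (hσ : 0 < σ) :
    ∃ K : ℝ, 0 ≤ K ∧ ∀ T : Mesh Ω, T.QuasiUniform σ → ∀ Xh : Submodule ℝ (H10 Ω),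
      IsFEVelocitySpace T k Xh → ∀ w ∈ Xh, ∀ u ∈ Xh, ∀ v ∈ Xh,
        |bStar w u v| ≤ K * (√T.size)⁻¹ * ‖grad w‖ * ‖grad u‖ * ‖val v‖ := by
  obtain ⟨A, hA, H⟩ := exists_norm_le_of_mem hd hΩ hΩb k hσ
  obtain ⟨S, hS⟩ := exists_eLpNorm_six_le hd hΩb
  -- After integration by parts, `b*(w, u, v) = (w·∇u, v) + ½ ((∇·w) u, v)`, whence `3/2 = 1 + 1/2`;
  -- `d²` counts the summands of each integrand.
  refine ⟨3 / 2 * ((d ^ 2 : ℕ) * (S * A)), by positivity, fun T hT Xh hX w hw u hu v hv => ?_⟩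
  set μ := volume.restrict Ω
  have hv3 := eLpNorm_three_le (val v) (by positivity) (H T hT Xh hX v hv)
  have hw' := memLp_top_of_mem hd hΩ hΩb hσ hT hX hw
  have hv' := memLp_top_of_mem hd hΩ hΩb hσ hT hX hv
  -- Used with `(a, b) = (w, u)` for the convective integral and `(u, w)` for the divergence one:
  -- the undifferentiated factor goes to `L⁶`, the gradient to `L²`.
  have key : ∀ (a : H10 Ω) (b : H10 Ω) (f : Vec d → ℝ),
      (∀ x, |f x| ≤ (d ^ 2 : ℕ) * (‖val a x‖ * ‖grad b x‖ * ‖val v x‖)) →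
      |∫ x in Ω, f x| ≤
        (d ^ 2 : ℕ) * (S * ‖grad a‖ * ‖grad b‖ * (A * (√T.size)⁻¹ * ‖val v‖)) := by
    intro a b f hf
    have h1 := enorm_integral_le_of_abs_le (μ := μ) ((d ^ 2 : ℕ) : NNReal)
      (Lp.aestronglyMeasurable (val a)) (Lp.aestronglyMeasurable (grad b))
      (Lp.aestronglyMeasurable (val v)) (by exact_mod_cast hf)
    have h2 : eLpNorm (grad b) 2 μ = ENNReal.ofReal ‖grad b‖ := by
      rw [Lp.norm_def, ENNReal.ofReal_toReal (Lp.eLpNorm_ne_top _)]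
    have h3 := h1.trans (mul_le_mul_right (mul_le_mul' (mul_le_mul' (hS a) h2.le) hv3) _)
    rw [← ENNReal.ofReal_coe_nnreal, ← ENNReal.ofReal_coe_nnreal,
      ← ENNReal.ofReal_mul (by positivity), ← ENNReal.ofReal_mul (by positivity),
      ← ENNReal.ofReal_mul (by positivity), ← ENNReal.ofReal_mul (by positivity), ← ofReal_norm,
      ENNReal.ofReal_le_ofReal_iff (by positivity)] at h3
    simpa using h3
  have k1 := key w u _ fun x => abs_sum_sum_le
      (fun i j => val w x j * grad u x (i, j) * val v x i) fun i j => by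
    rw [abs_mul, abs_mul]
    gcongr <;> exact abs_apply_le_norm _ _
  have k2 := key u w _ fun x => abs_sum_sum_le
      (fun i j => val u x i * grad w x (j, j) * val v x i) fun i j => by
    rw [abs_mul, abs_mul]
    gcongr <;> exact abs_apply_le_norm _ _
  rw [bStar, conv_by_parts w u v hw' hv']
  change |conv w u v| ≤ _ at k1
  rw [abs_le] at k1 k2 ⊢
  constructor <;> linarith [k1.1, k1.2, k2.1, k2.2]

/-! ### The discrete energy estimate. -/

lemma integrable_conv_sum {d : ℕ} {Ω : Set (Vec d)} (u v w : H10 Ω)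
    (hu : MemLp (val u) ⊤ (volume.restrict Ω)) :
    Integrable (fun x => ∑ i : Fin d, ∑ j : Fin d, val u x j * grad v x (i, j) * val w x i)
      (volume.restrict Ω) :=
  integrable_finsetSum _ fun i _ => integrable_finsetSum _ fun j _ => integrable_conv u v w hu i j

/-- Boundedness of the convecting field makes the triple products integrable, so that the integrals
can be split. -/
lemma bStar_sub_right {d : ℕ} {Ω : Set (Vec d)} (u v w z : H10 Ω)
    (hu : MemLp (val u) ⊤ (volume.restrict Ω)) :
    bStar u v (w - z) = bStar u v w - bStar u v z := by
  have h1 : conv u v (w - z) = conv u v w - conv u v z := by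
    refine Eq.trans ?_ (integral_sub (integrable_conv_sum u v w hu) (integrable_conv_sum u v z hu))
    apply integral_congr_ae
    filter_upwards [Lp.coeFn_sub (val w) (val z)] with x hx
    replace hx : val (w - z) x = val w x - val z x := hx
    simp only [hx, PiLp.sub_apply, mul_sub, Finset.sum_sub_distrib]
  have h2 : conv u (w - z) v = conv u w v - conv u z v := by
    refine Eq.trans ?_ (integral_sub (integrable_conv_sum u w v hu) (integrable_conv_sum u z v hu))
    apply integral_congr_ae
    filter_upwards [Lp.coeFn_sub (grad w) (grad z)] with x hx
    replace hx : grad (w - z) x = grad w x - grad z x := hx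
    simp only [hx, PiLp.sub_apply, mul_sub, sub_mul, Finset.sum_sub_distrib]
  rw [bStar, bStar, bStar, h1, h2]
  ring

lemma bStar_self {d : ℕ} {Ω : Set (Vec d)} (u v : H10 Ω) : bStar u v v = 0 :=
  sub_self _

lemma mean_mem {d : ℕ} {Ω : Set (Vec d)} {Xh : Submodule ℝ (H10 Ω)} {J : ℕ}
    {u : Fin J → ℕ → H10 Ω} {n : ℕ} (h : ∀ j, u j n ∈ Xh) : mean u n ∈ Xh :=
  Xh.smul_mem _ (Xh.sum_mem fun j _ => h j)

/-- The equation tested with `v = 0` says that `∇·u + ε p` is orthogonal to `Qh`, and `p` lies in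
`Qh`. -/
lemma IsEnsembleSolution.starProjection_divg {d : ℕ} {Ω : Set (Vec d)} {Xh : Submodule ℝ (H10 Ω)}
    {Qh : Submodule ℝ (L2 Ω ℝ)} [FiniteDimensional ℝ Qh] {ν ε Δt : ℝ} {J : ℕ}
    {f : Fin J → ℕ → (H10 Ω →L[ℝ] ℝ)} {N : ℕ} {u : Fin J → ℕ → H10 Ω} {p : Fin J → ℕ → L2 Ω ℝ}
    (h : IsEnsembleSolution Xh Qh ν ε Δt f N u p) (j : Fin J) {n : ℕ} (hn : n < N) :
    Qh.starProjection (divg (u j (n + 1))) = -ε • p j (n + 1) := by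
  refine Submodule.eq_starProjection_of_mem_of_inner_eq_zero
    (Qh.smul_mem _ (h.pressure_mem j n hn)) fun q hq => ?_
  -- Subtracting the instance `q = 0` removes all terms in `v = 0` without evaluating them.
  have h0 := h.step j n hn 0 Xh.zero_mem 0 Qh.zero_mem
  have h1 := h.step j n hn 0 Xh.zero_mem q hq
  rw [inner_zero_left, inner_zero_right] at h0
  rw [inner_sub_left, inner_smul_left, real_inner_comm]
  simp only [conj_trivial]
  linarith

/-- Real-number core of one step. Here `a`, `a'`, `c` are the `L²` norms of the new field, the old
field and the increment; `G`, `g` the new and old gradient norms; `P` the pressure norm; `D` the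
pressure-divergence pairing; `b`, `φ` the explicit and forcing terms. Forcing uses half of `ν Δt
G²`; the other half is split in two quarters, one to telescope and one to remain in the sum. -/
lemma energy_arith {ν ε Δt ip φ b B F c G g P D a a' : ℝ} (hν : 0 < ν) (hε : 0 < ε) (hΔ : 0 < Δt)
    (hs : 1 / Δt * ip + 0 + b + ν * G ^ 2 - D + D + ε * P ^ 2 = φ)
    (hi : 2 * ip = a ^ 2 - a' ^ 2 + c ^ 2) (hF : |φ| ≤ F * G) (hB : |b| ≤ B * g * c)
    (hcfl : 4 * B ^ 2 * Δt ≤ ν) :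
    1 / 2 * a ^ 2 + 1 / 4 * c ^ 2 + ν * Δt / 4 * G ^ 2 + ν * Δt / 4 * G ^ 2
        + Δt / ε * (ε ^ 2 * P ^ 2)
      ≤ Δt / (2 * ν) * F ^ 2 + 1 / 2 * a' ^ 2 + ν * Δt / 4 * g ^ 2 := by
  have hb1 : -b ≤ B * g * c := (neg_le_abs b).trans hB
  have hF1 : φ ≤ F * G := (le_abs_self φ).trans hF
  have hs' : ip = Δt * (φ - b - ν * G ^ 2 - ε * P ^ 2) := by
    rw [← hs]
    field_simp
    ring
  have y1 : Δt * (F * G) ≤ Δt / (2 * ν) * F ^ 2 + ν * Δt / 2 * G ^ 2 := by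
    have : Δt / (2 * ν) * F ^ 2 + ν * Δt / 2 * G ^ 2 - Δt * (F * G)
        = Δt / (2 * ν) * (F - ν * G) ^ 2 := by
      field_simp
      ring
    have h0 : 0 ≤ Δt / (2 * ν) * (F - ν * G) ^ 2 := by positivity
    linarith
  -- Young's inequality with weight `1/4` on `c²`; the CFL condition turns the remainder `(Δt B g)²`
  -- into `¼ ν Δt g²`.
  have y2 : Δt * (B * g * c) ≤ 1 / 4 * c ^ 2 + ν * Δt / 4 * g ^ 2 := by
    have h1 : Δt * (B * g * c) ≤ 1 / 4 * c ^ 2 + (Δt * B * g) ^ 2 := by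
      nlinarith [sq_nonneg (1 / 2 * c - Δt * B * g)]
    have h2 : (Δt * B * g) ^ 2 ≤ ν * Δt / 4 * g ^ 2 := by
      have := mul_le_mul_of_nonneg_right hcfl (by positivity : 0 ≤ Δt / 4 * g ^ 2)
      nlinarith
    linarith
  have z1 := mul_le_mul_of_nonneg_left hb1 hΔ.le
  have z2 := mul_le_mul_of_nonneg_left hF1 hΔ.le
  have e3 : Δt / ε * (ε ^ 2 * P ^ 2) = Δt * (ε * P ^ 2) := by
    field_simp
  rw [e3]
  linarith

/-- The energy estimate for a single time step. -/
lemma IsEnsembleSolution.energy_step {d : ℕ} {Ω : Set (Vec d)} {Xh : Submodule ℝ (H10 Ω)}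
    {Qh : Submodule ℝ (L2 Ω ℝ)} [FiniteDimensional ℝ Qh] {ν ε Δt : ℝ} {J : ℕ}
    {f : Fin J → ℕ → (H10 Ω →L[ℝ] ℝ)} {N : ℕ} {u : Fin J → ℕ → H10 Ω} {p : Fin J → ℕ → L2 Ω ℝ}
    (h : IsEnsembleSolution Xh Qh ν ε Δt f N u p) (hν : 0 < ν) (hε : 0 < ε) (hΔ : 0 < Δt)
    (j : Fin J) {n : ℕ} (hn : n < N) {F B : ℝ}
    (hF : |f j (n + 1) (u j (n + 1))| ≤ F * ‖grad (u j (n + 1))‖)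
    (hX : ∀ v ∈ Xh, MemLp (val v) ⊤ (volume.restrict Ω))
    (hB : |bStar (u j n - mean u n) (u j n) (u j (n + 1) - u j n)|
      ≤ B * ‖grad (u j n)‖ * ‖val (u j (n + 1) - u j n)‖)
    (hcfl : 4 * B ^ 2 * Δt ≤ ν) :
    1 / 2 * ‖val (u j (n + 1))‖ ^ 2 + 1 / 4 * ‖val (u j (n + 1) - u j n)‖ ^ 2
        + ν * Δt / 4 * ‖grad (u j (n + 1))‖ ^ 2 + ν * Δt / 4 * ‖grad (u j (n + 1))‖ ^ 2
        + Δt / ε * ‖Qh.starProjection (divg (u j (n + 1)))‖ ^ 2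
      ≤ Δt / (2 * ν) * F ^ 2 + 1 / 2 * ‖val (u j n)‖ ^ 2 + ν * Δt / 4 * ‖grad (u j n)‖ ^ 2 := by
  have hm : ∀ i, u i n ∈ Xh := fun i => h.velocity_mem i n hn.le
  have hw : u j n - mean u n ∈ Xh := Xh.sub_mem (hm j) (mean_mem hm)
  have hs := h.step j n hn (u j (n + 1)) (h.velocity_mem j (n + 1) hn) (p j (n + 1))
    (h.pressure_mem j n hn)
  rw [bStar_self, real_inner_self_eq_norm_sq, real_inner_self_eq_norm_sq] at hs
  -- Replaces the third argument `u_j^{n+1}` by the increment, as `b*(w, u_j^n, u_j^n) = 0`.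
  have hb := bStar_sub_right (u j n - mean u n) (u j n) (u j (n + 1)) (u j n) (hX _ hw)
  rw [bStar_self, sub_zero] at hb
  rw [← hb] at hs
  have hP : ‖Qh.starProjection (divg (u j (n + 1)))‖ ^ 2 = ε ^ 2 * ‖p j (n + 1)‖ ^ 2 := by
    rw [h.starProjection_divg j hn, norm_smul, mul_pow, norm_neg, Real.norm_eq_abs, sq_abs]
  have hi : 2 * inner ℝ (val (u j (n + 1) - u j n)) (val (u j (n + 1)))
      = ‖val (u j (n + 1))‖ ^ 2 - ‖val (u j n)‖ ^ 2 + ‖val (u j (n + 1) - u j n)‖ ^ 2 := by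
    have e : val (u j n) = val (u j (n + 1)) - val (u j (n + 1) - u j n) :=
      (sub_sub_cancel (val (u j (n + 1))) (val (u j n))).symm
    have h2 := norm_sub_sq_real (val (u j (n + 1))) (val (u j (n + 1) - u j n))
    rw [← e, real_inner_comm] at h2
    linarith
  rw [hP]
  exact energy_arith hν hε hΔ hs hi hF hB hcfl

lemma sum_energy_le {a b c g e F : ℕ → ℝ} {κ lam : ℝ} {N : ℕ}
    (h : ∀ n < N, a (n + 1) + b n + c (n + 1) + g n + κ * e n ≤ lam * F n + a n + c n) :
    a N + ∑ n ∈ Finset.range N, b n + c N + ∑ n ∈ Finset.range N, g n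
      + κ * ∑ n ∈ Finset.range N, e n ≤ lam * ∑ n ∈ Finset.range N, F n + a 0 + c 0 := by
  induction N with
  | zero => simp
  | succ N ih =>
    have h1 := ih fun n hn => h n (hn.trans N.lt_succ_self)
    have h2 := h N N.lt_succ_self
    simp only [Finset.sum_range_succ]
    linarith

end PenaltyEnsemble

open PenaltyEnsemble in
theorem mainTheorem1 (d : ℕ) (hd : d = 2 ∨ d = 3) (Ω : Set (Vec d)) (hΩ : IsOpen Ω)
    (hΩb : Bornology.IsBounded Ω) (k : ℕ) (σ : ℝ) (hσ : 0 < σ) :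
    ∃ C : ℝ, 0 < C ∧
      ∀ (T : Mesh Ω), T.QuasiUniform σ →
      ∀ (Xh : Submodule ℝ (H10 Ω)), IsFEVelocitySpace T k Xh →
      ∀ (Qh : Submodule ℝ (L2 Ω ℝ)) [FiniteDimensional ℝ Qh],
        (∀ q ∈ Qh, ∫ x in Ω, q x = 0) →
      ∀ (ν ε Δt : ℝ), 0 < ν → 0 < ε → 0 < Δt →
      ∀ (J : ℕ) (f : Fin J → ℕ → (H10 Ω →L[ℝ] ℝ)) (N : ℕ)
        (u : Fin J → ℕ → H10 Ω) (p : Fin J → ℕ → L2 Ω ℝ),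
        IsEnsembleSolution Xh Qh ν ε Δt f N u p →
      ∀ j : Fin J,
        (∀ n < N, C * (Δt / (ν * T.size)) * ‖grad (u j n - mean u n)‖ ^ 2 ≤ 1) →
        1 / 2 * ‖val (u j N)‖ ^ 2
          + 1 / 4 * ∑ n ∈ Finset.range N, ‖val (u j (n + 1) - u j n)‖ ^ 2
          + ν * Δt / 4 * ‖grad (u j N)‖ ^ 2
          + ν * Δt / 4 * ∑ n ∈ Finset.range N, ‖grad (u j (n + 1))‖ ^ 2
          + Δt / ε * ∑ n ∈ Finset.range N, ‖Qh.starProjection (divg (u j (n + 1)))‖ ^ 2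
        ≤ Δt / (2 * ν) * ∑ n ∈ Finset.range N, normNegOne (f j (n + 1)) ^ 2
          + 1 / 2 * ‖val (u j 0)‖ ^ 2
          + ν * Δt / 4 * ‖grad (u j 0)‖ ^ 2 := by
  obtain ⟨K, hK, hb⟩ := exists_abs_bStar_le hd hΩ hΩb k hσ
  -- With `B = K h^{-1/2} ‖∇w‖`, the requirement `4 B² Δt ≤ ν` is the CFL condition with constant `4
  -- K²`; the `+ 1` ensures positivity.
  refine ⟨4 * K ^ 2 + 1, by positivity,
    fun T hT Xh hX Qh _ _ ν ε Δt hν hε hΔ J f N u p h j hcfl => ?_⟩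
  have hs : 0 ≤ T.size := Real.iSup_nonneg fun K => Metric.diam_nonneg
  have hstep : ∀ n < N, _ := fun n hn =>
    h.energy_step hν hε hΔ j hn (F := normNegOne (f j (n + 1)))
      (B := K * (√T.size)⁻¹ * ‖grad (u j n - mean u n)‖)
      (apply_le_normNegOne_mul hd hΩb _ _)
      (fun v hv => memLp_top_of_mem hd hΩ hΩb hσ hT hX hv)
      (by
        have hm : ∀ i, u i n ∈ Xh := fun i => h.velocity_mem i n hn.le
        exact hb T hT Xh hX _ (Xh.sub_mem (hm j) (mean_mem hm)) _ (hm j) _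
          (Xh.sub_mem (h.velocity_mem j (n + 1) hn) (hm j)))
      (by
        have h1 := mul_le_mul_of_nonneg_left (hcfl n hn) hν.le
        have e : ν * ((4 * K ^ 2 + 1) * (Δt / (ν * T.size)) * ‖grad (u j n - mean u n)‖ ^ 2)
            = (4 * K ^ 2 + 1) * (Δt * (T.size)⁻¹ * ‖grad (u j n - mean u n)‖ ^ 2) := by
          rw [div_eq_mul_inv, mul_inv]
          field_simp
        rw [e, mul_one] at h1
        have h2 : 0 ≤ Δt * (T.size)⁻¹ * ‖grad (u j n - mean u n)‖ ^ 2 := by positivity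
        rw [mul_pow, mul_pow, inv_pow, Real.sq_sqrt hs]
        linarith)
  have := sum_energy_le (a := fun n => 1 / 2 * ‖val (u j n)‖ ^ 2)
    (b := fun n => 1 / 4 * ‖val (u j (n + 1) - u j n)‖ ^ 2)
    (c := fun n => ν * Δt / 4 * ‖grad (u j n)‖ ^ 2)
    (g := fun n => ν * Δt / 4 * ‖grad (u j (n + 1))‖ ^ 2)
    (e := fun n => ‖Qh.starProjection (divg (u j (n + 1)))‖ ^ 2)
    (F := fun n => normNegOne (f j (n + 1)) ^ 2) hstep
  simpa only [← Finset.mul_sum] using this
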